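/- **Setting.** Let $\mathcal{A}$ be a finite set of atoms. A *rule* is an expression $r = A\leftarrow B,\ not\,C,\ not\,not\,D$ with $A,B,C,D\subseteq\mathcal{A}$ (head $A$, positive body $B$); it is *disjunctive* if $D=\emptyset$, *normal* if moreover $|A|\le 1$, and *Horn* if moreover $C=\emptyset$ (constraints, $A=\emptyset$, are allowed). A *program* is a finite set of rules; it is disjunctive, normal or Horn if all its rules are; $\mathcal{C}_e,\mathcal{C}_d,\mathcal{C}_n,\mathcal{C}_H$ denote the classes of all, disjunctive, normal and Horn programs. $\mathcal{A}(r)$, $\mathcal{A}(P)$ denote the sets of atoms occurring in $r$, $P$. A set $I\subseteq\mathcal{A}$ satisfies $r$ if $B\subseteq I$, $C\cap I=\emptyset$, $D\subseteq I$ imply $A\cap I\ne\emptyset$, and $I\models P$ if $I$ satisfies all rules of $P$. The reduct is $P^I=\{A\leftarrow B : (A\leftarrow B,not\,C,not\,not\,D)\in P,\ C\cap I=\emptyset,\ D\subseteq I\}$. $\mathcal{HT}(P)$ is the set of pairs $\langle X,Y\rangle$ with $X\subseteq Y\subseteq\mathcal{A}$, $Y\models P$, $X\models P^Y$; for $S\subseteq\mathcal{A}$,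 $\mathcal{HT}_S(P)=\{\langle X,Y\rangle\in\mathcal{HT}(P): Y\subseteq S\}$. $P\models_{HT}Q$ means $\mathcal{HT}(P)\subseteq\mathcal{HT}(Q)$, and $P\equiv_{HT}Q$ means $\mathcal{HT}(P)=\mathcal{HT}(Q)$. $Y$ is an answer set of $P$ if $\langle Y,Y\rangle\in\mathcal{HT}(P)$ and $\langle X,Y\rangle\notin\mathcal{HT}(P)$ for all $X\subsetneq Y$; $\mathcal{AS}(P)$ is the set of answer sets. $P,Q$ are *strongly equivalent* if $\mathcal{AS}(P\cup R)=\mathcal{AS}(Q\cup R)$ for all programs $R$. For $V\subseteq\mathcal{A}$ put $\mathcal{M}_{\parallel V}=\{X\setminus V: X\in\mathcal{M}\}$ for a set $\mathcal{M}$ of sets of atoms, and $\mathcal{M}_{\dagger V}=\{\langle X,Y\rangle: X\subseteq Y\subseteq\mathcal{A},\ X\setminus V=H\setminus V,\ Y\setminus V=T\setminus V \text{ for some }\langle H,T\rangle\in\mathcal{M}\}$ for a set $\mathcal{M}$ of pairs $\langle H,T\rangle$ with $H\subseteq T\subseteq\mathcal{A}$. A *forgetting operator* with domain $\mathcal{C}(f)$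 (a class of programs) is a map $f:\mathcal{C}(f)\times 2^{\mathcal{A}}\to\mathcal{C}(f)$ such that $\mathcal{A}(f(P,V))\subseteq\mathcal{A}(P)\setminus V$. The classes below consist of the operators $f$ which satisfy the stated condition for all $P\in\mathcal{C}(f)$ and all $V\subseteq\mathcal{A}$. * $F_{strong}$, $F_{weak}$ ($\mathcal{C}(f)=\mathcal{C}_n$). For $a\in\mathcal{A}$ let $R(P,a)$ consist of all rules of $P$ and all rules $head(r_1)\leftarrow (body(r_1)\setminus\{a\})\cup body(r_2)$ with $r_1,r_2\in P$, $a$ in the positive body of $r_1$, $head(r_2)=\{a\}$. Let $f_{strong}(P,a)=\{r\in R(P,a): a\notin\mathcal{A}(r)\}$, and let $f_{weak}(P,a)$ consist of the rules obtained by deleting $not\,a$ from the body of those $r\in R(P,a)$ with $a$ neither in the head nor in the positive body. The condition is that $f(P,V)$ is obtained by applying $f_{strong}(\cdot,a)$, respectively $f_{weak}(\cdot,a)$, successively to the elements $a$ of $V$, each once, in some order. * $F_S$ ($\mathcal{C}(f)\subseteq\mathcal{C}_d$). Let $Cn(P)=\{r \text{ disjunctive}: P\models_{HT}\{r\},\ \mathcal{A}(r)\subseteq\mathcal{A}(P)\}$.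 $P_S(P,a)$ is obtained from $Cn(P)$ by removing the rules with $a$ in the positive body, deleting $a$ from the head of the rules with $not\,a$ in the body, and then removing the rules with $not\,a$ in the body or $a$ in the head. The condition is that $f(P,V)\equiv_{HT}P_S(P,V)$, where $P_S(P,V)$ is obtained by applying $P_S(\cdot,a)$ successively to the elements $a$ of $V$, each once, in some order. * $F_{HT}$: $\mathcal{HT}(f(P,V))=\mathcal{HT}(P)_{\dagger V}$. * $F_{SM}$: $\mathcal{HT}(f(P,V))$ is maximal under inclusion among the sets $\mathcal{HT}(Q)$ with $Q$ a program over $\mathcal{A}(P)\setminus V$ such that $\mathcal{HT}(Q)\subseteq\mathcal{HT}(P)_{\dagger V}$ and $\mathcal{AS}(Q)=\mathcal{AS}(P)_{\parallel V}$. * $F_{Sas}$ over a class $\mathcal{C}$ of programs with $\mathcal{C}_H\subseteq\mathcal{C}$ ($\mathcal{C}(f)\subseteq\mathcal{C}$): $\mathcal{AS}(f(P,V)\cup R)=\mathcal{AS}(P\cup R)_{\parallel V}$ for all $R\in\mathcal{C}$ with $\mathcal{A}(R)\subseteq\mathcal{A}(P)\setminus V$. * $F_{SE}$ ($\mathcal{C}(f)\subseteq\mathcal{C}_d$):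 $f(P,V)\equiv_{HT}\{r: r\text{ disjunctive},\ P\vdash_s r,\ \mathcal{A}(r)\subseteq\mathcal{A}(P)\setminus V\}$, where $\vdash_s$ is derivability from the rules of $P$ in Wong's inference system for disjunctive rules: $\vdash x\leftarrow x$; $\vdash\ \leftarrow x,not\,x$; from $A\leftarrow B,not\,C$ infer $A\cup X\leftarrow B\cup Y,not\,(C\cup Z)$; from $A_1\leftarrow B_1,x,not\,C_1$ and $A_2\cup\{x\}\leftarrow B_2,not\,C_2$ infer $A_1\cup A_2\leftarrow B_1\cup B_2,not\,(C_1\cup C_2)$; from $A_i\leftarrow B_i,not\,x_i,not\,C_i$ ($1\le i\le n$, $n\ge 0$) and $A\leftarrow x_1,\dots,x_n,not\,C$ infer $\bigcup_i A_i\leftarrow\bigcup_i B_i,not\,(\bigcup_i C_i\cup A\cup C)$. * For $Y\subseteq\mathcal{A}\setminus V$ let $Rel^Y=\{A\subseteq V:\langle Y\cup A,Y\cup A\rangle\in\mathcal{HT}(P),\ \langle Y\cup A',Y\cup A\rangle\notin\mathcal{HT}(P)\text{ for all }A'\subsetneq A\}$, $R^{Y,A}=\{X\setminus V:\langle X,Y\cup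 A\rangle\in\mathcal{HT}(P)\}$ and $\mathcal{R}^Y=\{R^{Y,A}: A\in Rel^Y\}$; the convention $\bigcap\emptyset=\emptyset$ is used for families $\mathcal{R}^Y$. $F_{SP}$: $\mathcal{HT}_{\mathcal{A}(P)\setminus V}(f(P,V))=\{\langle X,Y\rangle: Y\subseteq\mathcal{A}(P)\setminus V,\ X\in\bigcap\mathcal{R}^Y\}$. $F_R$: $\mathcal{HT}_{\mathcal{A}\setminus V}(f(P,V))=\{\langle X,Y\rangle: Y\subseteq\mathcal{A}\setminus V,\ X\in\bigcup\mathcal{R}^Y\}$. $F_M$: $\mathcal{HT}_{\mathcal{A}\setminus V}(f(P,V))=\{\langle X,Y\rangle: Y\subseteq\mathcal{A}\setminus V$, and $X\in\bigcup\mathcal{R}^Y$ if $\mathcal{R}^Y$ has no least element, $X\in\bigcap\mathcal{R}^Y$ otherwise$\}$. * $F_{UP}$: Let $Sel^Y=\{A\subseteq V:\langle Y\cup A,Y\cup A\rangle\in\mathcal{HT}(P)\}$, $T=\{Y\subseteq\mathcal{A}\setminus V: \text{there is }A\in Sel^Y\text{ with }\langle Y\cup A',Y\cup A\rangle\notin\mathcal{HT}(P)\text{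 for all }A'\subsetneq A\}$, $N^{Y,A}=\{X\setminus V:\langle X,Y\cup A\rangle\in\mathcal{HT}(P),\ X\ne Y\cup A\}$, and let $SInt^Y$ be the set of all intersections $\bigcap_{i\in Sel^Y}X_i$ with $X_i\in N^{Y,i}$ for each $i\in Sel^Y$. The condition is $\mathcal{HT}_{\mathcal{A}\setminus V}(f(P,V))=\{\langle Y,Y\rangle: Y\in T\}\cup\{\langle X,Y\rangle: Y\in T,\ X\in SInt^Y\}$. **Theorem.** Let $f_1,f_2$ be forgetting operators, each belonging to one of the classes $F_{strong}$, $F_{weak}$, $F_S$, $F_{HT}$, $F_{SM}$, $F_{Sas}$ (over some class of programs containing $\mathcal{C}_H$, possibly different for $f_1$ and $f_2$), $F_{SE}$, $F_{SP}$, $F_R$, $F_M$, $F_{UP}$. Then for every Horn program $P\in\mathcal{C}(f_1)\cap\mathcal{C}(f_2)$ and every $V\subseteq\mathcal{A}(P)$, $f_1(P,V)\equiv_{HT}f_2(P,V)$; equivalently, $f_1(P,V)$ and $f_2(P,V)$ are strongly equivalent. -/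

import Mathlib

namespace ASP

/-- An extended rule `A ← B, not C, not not D` over the propositional signature `α`, given by its
sets of atoms: `head = A`, `pos = B`, `neg = C`, `nneg = D`. The signature is finite wherever the
notions below are applied, so all these sets are finite. -/
@[ext]
structure Rule (α : Type*) where
  head : Set α
  pos : Set α
  neg : Set α
  nneg : Set α

/-- A logic program is a set of extended rules (over a finite signature there are only finitely
many rules, so every such set is finite). -/
abbrev Program (α : Type*) := Set (Rule α)

/-- HT-interpretations `⟨X, Y⟩` are pairs of sets of atoms (with `X ⊆ Y`). -/
abbrev HTInterp (α : Type*) := Set α × Set α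

variable {α : Type*}

/-- The atoms occurring in a rule. -/
def Rule.atoms (r : Rule α) : Set α := r.head ∪ r.pos ∪ r.neg ∪ r.nneg

/-- The set `𝒜(P)` of atoms occurring in `P`. -/
def atoms (P : Program α) : Set α := {a | ∃ r ∈ P, a ∈ r.atoms}

/-! ### Classes of rules and programs -/

def Rule.IsDisjunctive (r : Rule α) : Prop := r.nneg = ∅

def Rule.IsNormal (r : Rule α) : Prop := r.IsDisjunctive ∧ r.head.Subsingleton

def Rule.IsHorn (r : Rule α) : Prop := r.IsNormal ∧ r.neg = ∅

def disjunctivePrograms (α : Type*) : Set (Program α) := {P | ∀ r ∈ P, r.IsDisjunctive}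

def normalPrograms (α : Type*) : Set (Program α) := {P | ∀ r ∈ P, r.IsNormal}

def hornPrograms (α : Type*) : Set (Program α) := {P | ∀ r ∈ P, r.IsHorn}

/-! ### Semantics -/

/-- Classical satisfaction of a rule, read as an implication. -/
def Rule.SatBy (I : Set α) (r : Rule α) : Prop :=
  r.pos ⊆ I → Disjoint r.neg I → r.nneg ⊆ I → (r.head ∩ I).Nonempty

/-- Classical satisfaction `I ⊨ P`. -/
def Models (I : Set α) (P : Program α) : Prop := ∀ r ∈ P, r.SatBy I

/-- The reduct `P^I`. -/
def reduct (P : Program α) (I : Set α) : Program α :=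
  {s | ∃ r ∈ P, Disjoint r.neg I ∧ r.nneg ⊆ I ∧ s = ⟨r.head, r.pos, ∅, ∅⟩}

/-- The set `HT(P)` of HT-models of `P`. -/
def HT (P : Program α) : Set (HTInterp α) :=
  {M | M.1 ⊆ M.2 ∧ Models M.2 P ∧ Models M.1 (reduct P M.2)}

/-- The HT-models of `P` over the signature `S`. -/
def HTOn (S : Set α) (P : Program α) : Set (HTInterp α) := {M | M ∈ HT P ∧ M.2 ⊆ S}

/-- `P₁ ⊨_HT P₂`. -/
def HTEntails (P₁ P₂ : Program α) : Prop := HT P₁ ⊆ HT P₂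

/-- `P₁ ≡_HT P₂`. -/
def HTEquiv (P₁ P₂ : Program α) : Prop := HT P₁ = HT P₂

/-- The answer sets of `P`. -/
def AS (P : Program α) : Set (Set α) :=
  {Y | (Y, Y) ∈ HT P ∧ ¬ ∃ X, X ⊂ Y ∧ (X, Y) ∈ HT P}

/-- Strong equivalence: equal answer sets under the addition of any program. -/
def StronglyEquiv (P₁ P₂ : Program α) : Prop := ∀ R : Program α, AS (P₁ ∪ R) = AS (P₂ ∪ R)

/-- The `V`-exclusion of a set of answer sets. -/
def exclude (V : Set α) (M : Set (Set α)) : Set (Set α) := {Z | ∃ X ∈ M, Z = X \ V}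

/-- `M_{†V}`: the HT-interpretations that agree with an element of `M` outside `V`. -/
def dagger (M : Set (HTInterp α)) (V : Set α) : Set (HTInterp α) :=
  {N | N.1 ⊆ N.2 ∧ ∃ K ∈ M, N.1 \ V = K.1 \ V ∧ N.2 \ V = K.2 \ V}

/-! ### Forgetting operators -/

/-- A forgetting operator with domain `𝒞(f) = domain`: it maps `𝒞(f) × 2^𝒜` to `𝒞(f)`, and the
result of forgetting about `V` from `P` is a program over `𝒜(P) \ V`. Values outside the domain
are irrelevant. -/
structure ForgettingOperator (α : Type*) where
  domain : Set (Program α)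
  forget : Program α → Set α → Program α
  forget_mem : ∀ P ∈ domain, ∀ V, forget P V ∈ domain
  atoms_forget : ∀ P ∈ domain, ∀ V, atoms (forget P V) ⊆ atoms P \ V

/-- The list `l` enumerates the set of atoms `V` without repetition. -/
def Enumerates (l : List α) (V : Set α) : Prop := l.Nodup ∧ ∀ a, a ∈ l ↔ a ∈ V

/-! ### Strong and weak forgetting -/

/-- `P` together with all rules obtained from it by partial evaluation of the positive body
atom `a`. -/
def partialEval (P : Program α) (a : α) : Program α :=
  P ∪ {r | ∃ r₁ ∈ P, ∃ r₂ ∈ P, a ∈ r₁.pos ∧ r₂.head = {a} ∧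
    r = ⟨r₁.head, (r₁.pos \ {a}) ∪ r₂.pos, r₁.neg ∪ r₂.neg, r₁.nneg ∪ r₂.nneg⟩}

def forgetStrong (P : Program α) (a : α) : Program α :=
  {r | r ∈ partialEval P a ∧ a ∉ r.atoms}

def forgetWeak (P : Program α) (a : α) : Program α :=
  {s | ∃ r ∈ partialEval P a, a ∉ r.head ∪ r.pos ∧
    s = ⟨r.head, r.pos, r.neg \ {a}, r.nneg⟩}

/-- The operators on normal programs that forget about `V` by applying `forgetStrong`
sequentially to the elements of `V` (in some order). -/
def Fstrong (α : Type*) : Set (ForgettingOperator α) :=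
  {f | f.domain = normalPrograms α ∧ ∀ P ∈ f.domain, ∀ V,
    ∃ l, Enumerates l V ∧ f.forget P V = l.foldl forgetStrong P}

def Fweak (α : Type*) : Set (ForgettingOperator α) :=
  {f | f.domain = normalPrograms α ∧ ∀ P ∈ f.domain, ∀ V,
    ∃ l, Enumerates l V ∧ f.forget P V = l.foldl forgetWeak P}

/-! ### Semantic strong forgetting -/

/-- `Cn(P)`: the disjunctive HT-consequences of `P` over `𝒜(P)`. -/
def Cn (P : Program α) : Program α :=
  {r | r.IsDisjunctive ∧ HTEntails P {r} ∧ r.atoms ⊆ atoms P}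

open Classical in
/-- From `Cn(P)`, remove the rules with `a` in the positive body, and remove `a` from the head of
each rule with `not a` in its body. -/
noncomputable def cnStep (P : Program α) (a : α) : Program α :=
  {s | ∃ r ∈ Cn P, a ∉ r.pos ∧
    s = if a ∈ r.neg then ⟨r.head \ {a}, r.pos, r.neg, r.nneg⟩ else r}

/-- `P_S(P, a)`: then remove the rules with `not a` in the body and those with `a` in the head. -/
noncomputable def PS (P : Program α) (a : α) : Program α :=
  {r | r ∈ cnStep P a ∧ a ∉ r.neg ∧ a ∉ r.head}

def FS (α : Type*) : Set (ForgettingOperator α) :=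
  {f | f.domain ⊆ disjunctivePrograms α ∧ ∀ P ∈ f.domain, ∀ V,
    ∃ l, Enumerates l V ∧ HTEquiv (f.forget P V) (l.foldl PS P)}

/-! ### HT-forgetting and SM-forgetting -/

def FHT (α : Type*) : Set (ForgettingOperator α) :=
  {f | ∀ P ∈ f.domain, ∀ V, HT (f.forget P V) = dagger (HT P) V}

/-- The sets of HT-models of programs over `𝒜(P) \ V` that are contained in `HT(P)_{†V}` and have
the answer sets of `P`, up to `V`. -/
def IsSMCandidate (P : Program α) (V : Set α) (M : Set (HTInterp α)) : Prop :=
  ∃ Q : Program α, atoms Q ⊆ atoms P \ V ∧ M = HT Q ∧ M ⊆ dagger (HT P) V ∧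
    AS Q = exclude V (AS P)

def FSM (α : Type*) : Set (ForgettingOperator α) :=
  {f | ∀ P ∈ f.domain, ∀ V, Maximal (IsSMCandidate P V) (HT (f.forget P V))}

/-! ### Strong AS-forgetting, relative to a class `𝒞` of programs -/

def FSas (𝒞 : Set (Program α)) : Set (ForgettingOperator α) :=
  {f | f.domain ⊆ 𝒞 ∧ ∀ P ∈ f.domain, ∀ V, ∀ R ∈ 𝒞, atoms R ⊆ atoms P \ V →
    AS (f.forget P V ∪ R) = exclude V (AS (P ∪ R))}

/-! ### SE-forgetting -/

/-- The inference system `⊢ₛ` for disjunctive rules under strong equivalence. -/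
inductive SEDerives (P : Program α) : Rule α → Prop
  | ax (r : Rule α) : r ∈ P → SEDerives P r
  | taut (x : α) : SEDerives P ⟨{x}, {x}, ∅, ∅⟩
  | contra (x : α) : SEDerives P ⟨∅, {x}, {x}, ∅⟩
  | nonmin (A B C X Y Z : Set α) :
      SEDerives P ⟨A, B, C, ∅⟩ → SEDerives P ⟨A ∪ X, B ∪ Y, C ∪ Z, ∅⟩
  | wgppe (A₁ B₁ C₁ A₂ B₂ C₂ : Set α) (x : α) :
      SEDerives P ⟨A₁, B₁ ∪ {x}, C₁, ∅⟩ → SEDerives P ⟨A₂ ∪ {x}, B₂, C₂, ∅⟩ →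
      SEDerives P ⟨A₁ ∪ A₂, B₁ ∪ B₂, C₁ ∪ C₂, ∅⟩
  | shyp (n : ℕ) (A' B' C' : Fin n → Set α) (x : Fin n → α) (A C : Set α) :
      (∀ i, SEDerives P ⟨A' i, B' i, C' i ∪ {x i}, ∅⟩) →
      SEDerives P ⟨A, Set.range x, C, ∅⟩ →
      SEDerives P ⟨⋃ i, A' i, ⋃ i, B' i, (⋃ i, C' i) ∪ A ∪ C, ∅⟩

/-- `Cn_𝒜(P)`. -/
def CnSE (P : Program α) : Program α := {r | r.IsDisjunctive ∧ SEDerives P r}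

def FSE (α : Type*) : Set (ForgettingOperator α) :=
  {f | f.domain ⊆ disjunctivePrograms α ∧ ∀ P ∈ f.domain, ∀ V,
    HTEquiv (f.forget P V) (CnSE P ∩ {r | r.atoms ⊆ atoms P \ V})}

/-! ### SP-forgetting, relativized forgetting and `F_M`-forgetting -/

/-- `Rel^Y_{⟨P,V⟩}`. -/
def Rel (P : Program α) (V Y : Set α) : Set (Set α) :=
  {A | A ⊆ V ∧ (Y ∪ A, Y ∪ A) ∈ HT P ∧ ¬ ∃ A', A' ⊂ A ∧ (Y ∪ A', Y ∪ A) ∈ HT P}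

/-- `R^{Y,A}_{⟨P,V⟩}`. -/
def RSet (P : Program α) (V Y A : Set α) : Set (Set α) :=
  {Z | ∃ X, (X, Y ∪ A) ∈ HT P ∧ Z = X \ V}

/-- The family `𝓡^Y_{⟨P,V⟩}`. -/
def RFam (P : Program α) (V Y : Set α) : Set (Set (Set α)) :=
  {S | ∃ A ∈ Rel P V Y, S = RSet P V Y A}

/-- The intersection of a family; by convention, the intersection of the empty family is empty. -/
def interFam (F : Set (Set (Set α))) : Set (Set α) := {X | F.Nonempty ∧ X ∈ ⋂₀ F}

def FSP (α : Type*) : Set (ForgettingOperator α) :=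
  {f | ∀ P ∈ f.domain, ∀ V,
    HTOn (atoms P \ V) (f.forget P V) =
      {M | M.2 ⊆ atoms P \ V ∧ M.1 ∈ interFam (RFam P V M.2)}}

def FR (α : Type*) : Set (ForgettingOperator α) :=
  {f | ∀ P ∈ f.domain, ∀ V,
    HTOn Vᶜ (f.forget P V) = {M | M.2 ⊆ Vᶜ ∧ M.1 ∈ ⋃₀ RFam P V M.2}}

def FM (α : Type*) : Set (ForgettingOperator α) :=
  {f | ∀ P ∈ f.domain, ∀ V,
    HTOn Vᶜ (f.forget P V) = {M | M.2 ⊆ Vᶜ ∧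
      (((¬ ∃ S, IsLeast (RFam P V M.2) S) ∧ M.1 ∈ ⋃₀ RFam P V M.2) ∨
        ((∃ S, IsLeast (RFam P V M.2) S) ∧ M.1 ∈ interFam (RFam P V M.2)))}}

/-! ### Uniform forgetting -/

/-- `Sel^Y_{⟨P,V⟩}`. -/
def Sel (P : Program α) (V Y : Set α) : Set (Set α) := {A | A ⊆ V ∧ (Y ∪ A, Y ∪ A) ∈ HT P}

/-- `T_{⟨P,V⟩}`. -/
def TSet (P : Program α) (V : Set α) : Set (Set α) :=
  {Y | Y ⊆ Vᶜ ∧ ∃ A ∈ Sel P V Y, ∀ A', A' ⊂ A → (Y ∪ A', Y ∪ A) ∉ HT P}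

/-- `N^{Y,A}_{⟨P,V⟩}`. -/
def NSet (P : Program α) (V Y A : Set α) : Set (Set α) :=
  {Z | ∃ X, (X, Y ∪ A) ∈ HT P ∧ X ≠ Y ∪ A ∧ Z = X \ V}

/-- `SInt^Y_{⟨P,V⟩}`: the intersections of the tuples `(X_i)` with `X_i ∈ N^{Y,i}` for
`i ∈ Sel^Y_{⟨P,V⟩}`. -/
def SInt (P : Program α) (V Y : Set α) : Set (Set α) :=
  {Z | ∃ X : Sel P V Y → Set α, (∀ i : Sel P V Y, X i ∈ NSet P V Y (i : Set α)) ∧ Z = ⋂ i, X i}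

def FUP (α : Type*) : Set (ForgettingOperator α) :=
  {f | ∀ P ∈ f.domain, ∀ V,
    HTOn Vᶜ (f.forget P V) =
      {M | ∃ Y ∈ TSet P V, M = (Y, Y)} ∪ {M | M.2 ∈ TSet P V ∧ M.1 ∈ SInt P V M.2}}

end ASP

/-!
For a Horn program `P`, the HT-models are the pairs `X ⊆ Y` of classical models, and the classical
models are closed under intersection. Let `K` be the set of interpretations that agree with a model
of `P` outside `V` (`saturation (modelSet P) V`), that is, the models of `∃ V, P`. It is again
closed under intersection and depends on the atoms in `𝒜(P) \ V` only. In each of the classes the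
result of forgetting has exactly the pairs `X ⊆ Y` from `K` as HT-models (`HT_forget_eq`), so any
two results are HT-equivalent, and HT-equivalence implies strong equivalence.

* Strong and weak forgetting coincide on Horn programs, and resolving away one atom computes the
  existential quantification (`modelSet_forgetStrong`).
* A set closed under intersection is axiomatized by its Horn theory (`modelSet_hornTheory`). Hence
  every sound set of rules over `𝒜(P) \ V` that contains all Horn consequences has the right
  HT-models; this covers semantic strong forgetting (`HT_foldl_PS`) and, as the inference system is
  sound and derives all Horn consequences (`SEDerives.of_isHorn`), SE-forgetting.
* On pairs, HT-forgetting is saturation (`dagger_htPairs`). The answer sets of a program with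
  HT-models `htPairs K` are the least elements of `K`, so `htPairs K` is itself a candidate for
  SM-forgetting, hence the greatest one (`isSMCandidate_htPairs`).
* For strong AS-forgetting, facts together with rules `y ← y'` are contexts that tell HT-models
  apart, and they are Horn (`HT_eq_htPairs_of_AS_union`).
* The remaining classes are defined from the minimal `A ⊆ V` for which `Y ∪ A` is a model. By
  closure under intersection there is at most one such `A`, so that the unions, intersections and
  tuples in these definitions collapse (`RFam_eq`, `mem_SInt_iff`).
-/

namespace ASP

variable {α : Type*}

/-! ### Sets of interpretations closed under intersection -/

/-- Membership in `K` depends on the atoms in `S` only. -/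
def DeterminedOn (K : Set (Set α)) (S : Set α) : Prop :=
  ∀ ⦃X X' : Set α⦄, X ∩ S = X' ∩ S → X ∈ K → X' ∈ K

/-- The interpretations that agree with an element of `K` outside `V`, i.e. the models of
`∃ V, K`. -/
def saturation (K : Set (Set α)) (V : Set α) : Set (Set α) := {X | ∃ H ∈ K, X \ V = H \ V}

/-- The HT-interpretations both of whose components lie in `K`. The HT-models of a Horn program
are of this form. -/
def htPairs (K : Set (Set α)) : Set (HTInterp α) := {M | M.1 ⊆ M.2 ∧ M.1 ∈ K ∧ M.2 ∈ K}

theorem subset_saturation (K : Set (Set α)) (V : Set α) : K ⊆ saturation K V :=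
  fun X hX => ⟨X, hX, rfl⟩

theorem saturation_empty (K : Set (Set α)) : saturation K ∅ = K := by
  ext X; simp [saturation]

theorem diff_mem_saturation {K : Set (Set α)} {V X : Set α} (hX : X ∈ saturation K V) :
    X \ V ∈ saturation K V := by
  obtain ⟨H, hH, h⟩ := hX
  exact ⟨H, hH, by simpa using h⟩

theorem saturation_saturation (K : Set (Set α)) (V W : Set α) :
    saturation (saturation K V) W = saturation K (V ∪ W) := by
  ext X
  constructor
  · rintro ⟨H', ⟨H, hH, h⟩, h'⟩
    refine ⟨H, hH, ?_⟩
    rw [Set.union_comm, ← Set.sdiff_sdiff, h', Set.sdiff_sdiff, Set.union_comm, ← Set.sdiff_sdiff,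
      h,
      Set.sdiff_sdiff]
  · rintro ⟨H, hH, h⟩
    refine ⟨(X \ W) ∪ (H ∩ W), ⟨H, hH, ?_⟩, ?_⟩ <;> rw [Set.ext_iff] at h ⊢ <;> intro x <;>
      have := h x <;> simp only [Set.mem_sdiff, Set.mem_union, Set.mem_inter_iff] at this ⊢ <;>
      tauto

theorem infClosed_saturation {K : Set (Set α)} (hK : InfClosed K) (V : Set α) :
    InfClosed (saturation K V) := by
  rintro X ⟨H, hH, h⟩ X' ⟨H', hH', h'⟩
  refine ⟨H ∩ H', hK hH hH', ?_⟩
  rw [inf_sdiff, h, h']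
  exact inf_sdiff.symm

theorem DeterminedOn.saturation {K : Set (Set α)} {S : Set α} (hS : DeterminedOn K S)
    (V : Set α) : DeterminedOn (saturation K V) (S \ V) := by
  rintro X X' hXX' ⟨H, hH, h⟩
  -- Outside `V` the witness has to follow `X'`, which agrees with `X`, hence with `H`, on `S \ V`.
  refine ⟨(X' \ V) ∪ (H ∩ V), hS ?_ hH, ?_⟩ <;> rw [Set.ext_iff] at * <;> intro x <;>
    have h₁ := h x <;> have h₂ := hXX' x <;>
    simp only [Set.mem_sdiff, Set.mem_union, Set.mem_inter_iff] at h₁ h₂ ⊢ <;> tauto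

theorem DeterminedOn.inter_mem_iff {K : Set (Set α)} {S : Set α} (hS : DeterminedOn K S)
    (X : Set α) : X ∩ S ∈ K ↔ X ∈ K :=
  ⟨fun h => hS (by simp [Set.inter_assoc]) h, fun h => hS (by simp [Set.inter_assoc]) h⟩

theorem saturation_inter_of_determinedOn {K L : Set (Set α)} {V : Set α}
    (hL : DeterminedOn L Vᶜ) : saturation (K ∩ L) V = saturation K V ∩ L := by
  ext X
  constructor
  · rintro ⟨H, ⟨hK, hH⟩, h⟩
    exact ⟨⟨H, hK, h⟩, hL (by rw [← Set.sdiff_eq, ← Set.sdiff_eq, h]) hH⟩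
  · rintro ⟨⟨H, hH, h⟩, hX⟩
    exact ⟨H, ⟨hH, hL (by rw [← Set.sdiff_eq, ← Set.sdiff_eq, h]) hX⟩, h⟩

/-- Forgetting on the level of HT-models. The here-world needs no separate witness: if `H` and `T`
are witnesses for `X ⊆ Y`, then so are `H ∩ T ⊆ T`. -/
theorem dagger_htPairs {K : Set (Set α)} (hK : InfClosed K) (V : Set α) :
    dagger (htPairs K) V = htPairs (saturation K V) := by
  ext ⟨X, Y⟩
  constructor
  · rintro ⟨hXY, ⟨H, T⟩, ⟨-, hH, hT⟩, h, h'⟩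
    exact ⟨hXY, ⟨H, hH, h⟩, ⟨T, hT, h'⟩⟩
  · rintro ⟨hXY, ⟨H, hH, h⟩, ⟨T, hT, h'⟩⟩
    refine ⟨hXY, (H ∩ T, T), ⟨Set.inter_subset_right, hK hH hT, hT⟩, ?_, h'⟩
    change X \ V = (H ⊓ T) \ V
    rw [inf_sdiff, ← h, ← h']
    exact (inf_eq_left.2 (sdiff_le_sdiff_right hXY)).symm

theorem exists_isLeast_of_infClosed [Finite α] {K : Set (Set α)} (hK : InfClosed K)
    (hne : K.Nonempty) : ∃ M, IsLeast K M :=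
  ⟨sInf K, hK.sInf_mem_of_nonempty (Set.toFinite K) hne subset_rfl, fun _ hX => sInf_le hX⟩

theorem isLeast_saturation_iff [Finite α] {K : Set (Set α)} (hK : InfClosed K) {V Y : Set α} :
    (IsLeast (saturation K V) Y) ↔ ∃ M, IsLeast K M ∧ Y = M \ V := by
  have key : ∀ M, IsLeast K M → IsLeast (saturation K V) (M \ V) := by
    rintro M ⟨hM, hle⟩
    refine ⟨⟨M, hM, by simp⟩, ?_⟩
    rintro X ⟨H, hH, h⟩
    exact (Set.sdiff_subset_sdiff_left (hle hH)).trans (h ▸ Set.sdiff_subset)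
  constructor
  · intro hY
    obtain ⟨H, hH, -⟩ := hY.1
    obtain ⟨M, hM⟩ := exists_isLeast_of_infClosed hK ⟨H, hH⟩
    exact ⟨M, hM, hY.unique (key M hM)⟩
  · rintro ⟨M, hM, rfl⟩
    exact key M hM

/-! ### HT-models -/

/-- `⟨X, Y⟩` is an HT-model of the rule `r`. -/
def Rule.HTSat (X Y : Set α) (r : Rule α) : Prop :=
  Disjoint r.neg Y → r.nneg ⊆ Y →
    (r.pos ⊆ Y → (r.head ∩ Y).Nonempty) ∧ (r.pos ⊆ X → (r.head ∩ X).Nonempty)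

theorem mem_HT_iff {P : Program α} {X Y : Set α} :
    (X, Y) ∈ HT P ↔ X ⊆ Y ∧ ∀ r ∈ P, r.HTSat X Y := by
  constructor
  · rintro ⟨hXY, hY, hX⟩
    refine ⟨hXY, fun r hr hn hnn => ⟨fun hp => hY r hr hp hn hnn, fun hp => ?_⟩⟩
    exact hX ⟨r.head, r.pos, ∅, ∅⟩ ⟨r, hr, hn, hnn, rfl⟩ hp (by simp) (by simp)
  · rintro ⟨hXY, h⟩
    refine ⟨hXY, fun r hr hp hn hnn => (h r hr hn hnn).1 hp, ?_⟩
    rintro _ ⟨r, hr, hn, hnn, rfl⟩ hp - -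
    exact (h r hr hn hnn).2 hp

theorem HTEntails_singleton_iff {P : Program α} {r : Rule α} :
    HTEntails P {r} ↔ ∀ X Y, (X, Y) ∈ HT P → r.HTSat X Y := by
  constructor
  · intro h X Y hXY
    exact (mem_HT_iff.1 (h hXY)).2 r rfl
  · rintro h ⟨X, Y⟩ hXY
    exact mem_HT_iff.2 ⟨hXY.1, by rintro _ rfl; exact h X Y hXY⟩

theorem HT_union (P R : Program α) : HT (P ∪ R) = HT P ∩ HT R := by
  ext ⟨X, Y⟩
  simp only [Set.mem_inter_iff, mem_HT_iff, Set.mem_union, or_imp, forall_and]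
  tauto

theorem HTEquiv.stronglyEquiv {P Q : Program α} (h : HTEquiv P Q) : StronglyEquiv P Q := by
  intro R
  have h' : HT (P ∪ R) = HT (Q ∪ R) := by rw [HT_union, HT_union, show HT P = HT Q from h]
  simp only [AS, h']

theorem subset_iff_of_inter_eq {A S X X' : Set α} (hA : A ⊆ S) (h : X ∩ S = X' ∩ S) :
    A ⊆ X ↔ A ⊆ X' := by
  have key : ∀ Z : Set α, A ⊆ Z ↔ A ⊆ Z ∩ S := fun Z => by simp [hA]
  rw [key X, key X', h]

theorem inter_eq_of_inter_eq {A S X X' : Set α} (hA : A ⊆ S) (h : X ∩ S = X' ∩ S) :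
    A ∩ X = A ∩ X' := by
  rw [← Set.inter_eq_left.2 hA, Set.inter_assoc, Set.inter_assoc, Set.inter_comm S,
    Set.inter_comm S, h]

theorem Rule.HTSat.congr {r : Rule α} {S X X' Y Y' : Set α} (hr : r.atoms ⊆ S)
    (hX : X ∩ S = X' ∩ S) (hY : Y ∩ S = Y' ∩ S) (h : r.HTSat X Y) : r.HTSat X' Y' := by
  simp only [Rule.atoms, Set.union_subset_iff] at hr
  obtain ⟨⟨⟨hh, hp⟩, hn⟩, hnn⟩ := hr
  simp only [Rule.HTSat, Set.disjoint_iff_inter_eq_empty] at h ⊢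
  rwa [← inter_eq_of_inter_eq hn hY, ← subset_iff_of_inter_eq hnn hY,
    ← subset_iff_of_inter_eq hp hY, ← subset_iff_of_inter_eq hp hX, ← inter_eq_of_inter_eq hh hX,
    ← inter_eq_of_inter_eq hh hY]

theorem atoms_subset_of_mem {P : Program α} {r : Rule α} (hr : r ∈ P) : r.atoms ⊆ atoms P :=
  fun _ ha => ⟨r, hr, ha⟩

theorem mem_HT_inter_iff {P : Program α} {S X Y : Set α} (hS : atoms P ⊆ S) (hXY : X ⊆ Y) :
    (X ∩ S, Y ∩ S) ∈ HT P ↔ (X, Y) ∈ HT P := by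
  have hr : ∀ r ∈ P, r.atoms ⊆ S := fun r hr => (atoms_subset_of_mem hr).trans hS
  simp only [mem_HT_iff, hXY, Set.inter_subset_inter_left S hXY, true_and]
  exact forall₂_congr fun r hrP => ⟨Rule.HTSat.congr (hr r hrP) (by simp [Set.inter_assoc])
    (by simp [Set.inter_assoc]), Rule.HTSat.congr (hr r hrP) (by simp [Set.inter_assoc])
    (by simp [Set.inter_assoc])⟩

/-- For a program over `S`, the HT-models with components inside `S` determine all others. -/
theorem HT_eq_htPairs_of_forall_subset {P : Program α} {S S' : Set α} {K : Set (Set α)}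
    (hS : atoms P ⊆ S) (hK : DeterminedOn K S) (hSS' : S ⊆ S')
    (h : ∀ X Y, X ⊆ Y → Y ⊆ S' → ((X, Y) ∈ HT P ↔ X ∈ K ∧ Y ∈ K)) : HT P = htPairs K := by
  ext ⟨X, Y⟩
  by_cases hXY : X ⊆ Y
  · rw [← mem_HT_inter_iff hS hXY, h _ _ (Set.inter_subset_inter_left S hXY)
      (Set.inter_subset_right.trans hSS'), hK.inter_mem_iff, hK.inter_mem_iff]
    exact ⟨fun h => ⟨hXY, h⟩, fun h => h.2⟩
  · exact ⟨fun h => absurd h.1 hXY, fun h => absurd h.1 hXY⟩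

theorem mem_AS_iff_isLeast {P : Program α} {K : Set (Set α)} (hK : InfClosed K)
    (hP : HT P = htPairs K) {Y : Set α} : Y ∈ AS P ↔ IsLeast K Y := by
  simp only [AS, hP, htPairs, Set.mem_ofPred_eq]
  constructor
  · rintro ⟨⟨-, hY, -⟩, hmin⟩
    refine ⟨hY, fun X hX => ?_⟩
    by_contra hne
    have hsub : X ∩ Y ⊂ Y := ⟨Set.inter_subset_right, fun h => hne (h.trans Set.inter_subset_left)⟩
    exact hmin ⟨X ∩ Y, hsub, hsub.1, hK hX hY, hY⟩
  · rintro ⟨hY, hle⟩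
    exact ⟨⟨subset_rfl, hY, hY⟩, fun ⟨X, hX, _, hXK, _⟩ => hX.2 (hle hXK)⟩

/-! ### Horn programs -/

/-- The set of classical models of a program. -/
def modelSet (P : Program α) : Set (Set α) := {X | Models X P}

theorem Rule.IsHorn.htSat_iff {r : Rule α} (hr : r.IsHorn) {X Y : Set α} :
    r.HTSat X Y ↔ r.SatBy X ∧ r.SatBy Y := by
  obtain ⟨⟨hnn, -⟩, hn⟩ := hr
  rw [Rule.IsDisjunctive] at hnn
  simp [Rule.HTSat, Rule.SatBy, hnn, hn, and_comm]

theorem Rule.IsHorn.satBy_iff {r : Rule α} (hr : r.IsHorn) {X : Set α} :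
    r.SatBy X ↔ (r.pos ⊆ X → (r.head ∩ X).Nonempty) := by
  obtain ⟨⟨hnn, -⟩, hn⟩ := hr
  rw [Rule.IsDisjunctive] at hnn
  simp [Rule.SatBy, hnn, hn]

theorem HT_eq_htPairs_modelSet {P : Program α} (hP : P ∈ hornPrograms α) :
    HT P = htPairs (modelSet P) := by
  ext ⟨X, Y⟩
  simp only [mem_HT_iff, htPairs, modelSet, Models, Set.mem_ofPred_eq, ← forall₂_and]
  exact and_congr_right fun _ => forall₂_congr fun r hr => (hP r hr).htSat_iff

theorem infClosed_modelSet {P : Program α} (hP : P ∈ hornPrograms α) :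
    InfClosed (modelSet P) := by
  intro X hX X' hX' r hr
  have h := (hP r hr).satBy_iff.1 (hX r hr)
  have h' := (hP r hr).satBy_iff.1 (hX' r hr)
  refine (hP r hr).satBy_iff.2 fun hp => ?_
  obtain ⟨x, hx, hxX⟩ := h (hp.trans Set.inter_subset_left)
  obtain ⟨x', hx', hxX'⟩ := h' (hp.trans Set.inter_subset_right)
  obtain rfl := (hP r hr).1.2 hx hx'
  exact ⟨x, hx, hxX, hxX'⟩

theorem determinedOn_modelSet {P : Program α} (hP : P ∈ hornPrograms α) {S : Set α}
    (hS : atoms P ⊆ S) : DeterminedOn (modelSet P) S := by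
  intro X X' h hX r hr
  have := Rule.HTSat.congr ((atoms_subset_of_mem hr).trans hS) h h
    ((hP r hr).htSat_iff.2 ⟨hX r hr, hX r hr⟩)
  exact ((hP r hr).htSat_iff.1 this).1

theorem modelSet_union (P R : Program α) : modelSet (P ∪ R) = modelSet P ∩ modelSet R := by
  ext X
  simp only [modelSet, Models, Set.mem_union, or_imp, forall_and]
  rfl

theorem union_mem_hornPrograms {P R : Program α} (hP : P ∈ hornPrograms α)
    (hR : R ∈ hornPrograms α) : P ∪ R ∈ hornPrograms α := by
  rintro r (hr | hr)
  exacts [hP r hr, hR r hr]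

/-- The Horn rules over `S` that hold in every element of `K`. -/
def hornTheory (K : Set (Set α)) (S : Set α) : Program α :=
  {r | r.IsHorn ∧ r.atoms ⊆ S ∧ ∀ M ∈ K, r.SatBy M}

/-- A set of interpretations that is closed under intersection and determined by `S` is axiomatized
by its Horn theory over `S`. Let `X ∉ K`. If no element of `K` contains `X ∩ S`, the constraint
`← X ∩ S` holds in `K` and fails in `X`. Otherwise the least one that does has an atom
`y ∈ S \ X`, and `y ← X ∩ S` holds in `K` and fails in `X`. -/
theorem modelSet_hornTheory [Finite α] {K : Set (Set α)} {S : Set α} (hK : InfClosed K)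
    (hS : DeterminedOn K S) : modelSet (hornTheory K S) = K := by
  refine Set.Subset.antisymm (fun X hX => ?_) fun X hX r hr => hr.2.2 X hX
  by_contra hXK
  have hclosed : InfClosed {M | M ∈ K ∧ X ∩ S ⊆ M} := fun M hM M' hM' =>
    ⟨hK hM.1 hM'.1, Set.subset_inter hM.2 hM'.2⟩
  by_cases hne : {M | M ∈ K ∧ X ∩ S ⊆ M}.Nonempty
  · obtain ⟨M, ⟨hMK, hXM⟩, hle⟩ := exists_isLeast_of_infClosed hclosed hne
    obtain ⟨y, ⟨hyM, hyS⟩, hyX⟩ : ∃ y ∈ M ∩ S, y ∉ X := by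
      by_contra! hsub
      refine hXK (hS (Set.Subset.antisymm ?_ ?_) hMK)
      · exact fun y hy => ⟨hsub y hy, hy.2⟩
      · exact fun y hy => ⟨hXM hy, hy.2⟩
    have hr : (⟨{y}, X ∩ S, ∅, ∅⟩ : Rule α).IsHorn := ⟨⟨rfl, Set.subsingleton_singleton⟩, rfl⟩
    have hmem : (⟨{y}, X ∩ S, ∅, ∅⟩ : Rule α) ∈ hornTheory K S := by
      refine ⟨hr, by simp [Rule.atoms, hyS, Set.insert_subset_iff], fun N hN => ?_⟩
      exact hr.satBy_iff.2 fun hp => ⟨y, rfl, hle ⟨hN, hp⟩ hyM⟩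
    obtain ⟨z, rfl, hz⟩ := hr.satBy_iff.1 (hX _ hmem) Set.inter_subset_left
    exact hyX hz
  · have hr : (⟨∅, X ∩ S, ∅, ∅⟩ : Rule α).IsHorn := ⟨⟨rfl, Set.subsingleton_empty⟩, rfl⟩
    have hmem : (⟨∅, X ∩ S, ∅, ∅⟩ : Rule α) ∈ hornTheory K S := by
      refine ⟨hr, by simp [Rule.atoms], fun N hN => ?_⟩
      exact hr.satBy_iff.2 fun hp => absurd ⟨N, hN, hp⟩ hne
    obtain ⟨z, hz, -⟩ := hr.satBy_iff.1 (hX _ hmem) Set.inter_subset_left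
    exact hz

theorem hornTheory_mem_hornPrograms (K : Set (Set α)) (S : Set α) :
    hornTheory K S ∈ hornPrograms α := fun _ hr => hr.1

theorem atoms_hornTheory_subset (K : Set (Set α)) (S : Set α) : atoms (hornTheory K S) ⊆ S := by
  rintro a ⟨r, hr, ha⟩
  exact hr.2.1 ha

theorem HT_hornTheory [Finite α] {K : Set (Set α)} {S : Set α} (hK : InfClosed K)
    (hS : DeterminedOn K S) : HT (hornTheory K S) = htPairs K := by
  rw [HT_eq_htPairs_modelSet (hornTheory_mem_hornPrograms K S), modelSet_hornTheory hK hS]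

/-- A sound set of rules that contains the Horn theory of `K` has exactly the pairs from `K` as
HT-models. -/
theorem HT_eq_htPairs_of_hornTheory_subset [Finite α] {K : Set (Set α)} {S : Set α}
    {Q : Program α} (hK : InfClosed K) (hS : DeterminedOn K S) (hQ : hornTheory K S ⊆ Q)
    (hsound : ∀ r ∈ Q, ∀ X Y, (X, Y) ∈ htPairs K → r.HTSat X Y) : HT Q = htPairs K := by
  refine Set.Subset.antisymm ?_ fun ⟨X, Y⟩ hXY => mem_HT_iff.2 ⟨hXY.1, fun r hr =>
    hsound r hr X Y hXY⟩
  rw [← HT_hornTheory hK hS]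
  rintro ⟨X, Y⟩ hXY
  rw [mem_HT_iff] at hXY ⊢
  exact ⟨hXY.1, fun r hr => hXY.2 r (hQ hr)⟩

/-! ### Strong and weak forgetting -/

theorem partialEval_mem_hornPrograms {P : Program α} (hP : P ∈ hornPrograms α) (a : α) :
    partialEval P a ∈ hornPrograms α := by
  rintro r (hr | ⟨r₁, hr₁, r₂, hr₂, -, -, rfl⟩)
  · exact hP r hr
  · obtain ⟨⟨hnn₁, hh₁⟩, hn₁⟩ := hP r₁ hr₁
    obtain ⟨⟨hnn₂, -⟩, hn₂⟩ := hP r₂ hr₂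
    rw [Rule.IsDisjunctive] at hnn₁ hnn₂
    exact ⟨⟨by simp [Rule.IsDisjunctive, hnn₁, hnn₂], hh₁⟩, by simp [hn₁, hn₂]⟩

theorem modelSet_partialEval {P : Program α} (hP : P ∈ hornPrograms α) (a : α) :
    modelSet (partialEval P a) = modelSet P := by
  refine Set.Subset.antisymm (fun X hX r hr => hX r (Or.inl hr)) fun X hX r hr => ?_
  refine (partialEval_mem_hornPrograms hP a r hr).satBy_iff.2 fun hp => ?_
  obtain hr | ⟨r₁, hr₁, r₂, hr₂, -, hhead, rfl⟩ := hr
  · exact (hP r hr).satBy_iff.1 (hX r hr) hp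
  · rw [Set.union_subset_iff] at hp
    obtain ⟨b, hb, hbX⟩ := (hP r₂ hr₂).satBy_iff.1 (hX r₂ hr₂) hp.2
    rw [hhead, Set.mem_singleton_iff] at hb
    subst hb
    refine (hP r₁ hr₁).satBy_iff.1 (hX r₁ hr₁) fun x hx => ?_
    by_cases hxb : x = b
    · exact hxb ▸ hbX
    · exact hp.1 ⟨hx, hxb⟩

theorem forgetStrong_mem_hornPrograms {P : Program α} (hP : P ∈ hornPrograms α) (a : α) :
    forgetStrong P a ∈ hornPrograms α :=
  fun r hr => partialEval_mem_hornPrograms hP a r hr.1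

/-- On Horn programs there is no `not a` to delete, so weak and strong forgetting coincide. -/
theorem forgetWeak_eq_forgetStrong {P : Program α} (hP : P ∈ hornPrograms α) (a : α) :
    forgetWeak P a = forgetStrong P a := by
  have key : ∀ r : Rule α, r ∈ partialEval P a → r.neg = ∅ ∧ r.nneg = ∅ := fun r hr =>
    ⟨(partialEval_mem_hornPrograms hP a r hr).2, (partialEval_mem_hornPrograms hP a r hr).1.1⟩
  ext s
  constructor
  · rintro ⟨r, hr, ha, rfl⟩
    obtain ⟨hn, hnn⟩ := key r hr
    have heq : (⟨r.head, r.pos, r.neg \ {a}, r.nneg⟩ : Rule α) = r := by ext <;> simp [hn]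
    rw [heq]
    exact ⟨hr, by simpa [Rule.atoms, hn, hnn] using ha⟩
  · rintro ⟨hr, ha⟩
    obtain ⟨hn, hnn⟩ := key s hr
    refine ⟨s, hr, ?_, by ext <;> simp [hn]⟩
    simpa [Rule.atoms, hn, hnn] using ha

/-- Eliminating `a` by resolution. If `X \ {a}` violates `P` only through a rule `a ← B`, and
`X ∪ {a}` violates a rule `r₁` with `a` in its body, then `X` violates their resolvent. -/
theorem modelSet_forgetStrong {P : Program α} (hP : P ∈ hornPrograms α) (a : α) :
    modelSet (forgetStrong P a) = saturation (modelSet P) {a} := by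
  have hHorn := partialEval_mem_hornPrograms hP a
  ext X
  constructor
  · intro hX
    by_contra hsat
    have h₀ : ¬ Models (X \ {a}) P := fun h => hsat ⟨_, h, by simp⟩
    have h₁ : ¬ Models (X ∪ {a}) P := fun h => hsat ⟨_, h, by simp⟩
    simp only [Models, not_forall] at h₀ h₁
    obtain ⟨r₂, hr₂, h₂⟩ := h₀
    obtain ⟨r₁, hr₁, h₁⟩ := h₁
    rw [(hP r₂ hr₂).satBy_iff, Classical.not_imp, Set.not_nonempty_iff_eq_empty,
      ← Set.disjoint_iff_inter_eq_empty] at h₂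
    rw [(hP r₁ hr₁).satBy_iff, Classical.not_imp, Set.not_nonempty_iff_eq_empty,
      ← Set.disjoint_iff_inter_eq_empty] at h₁
    obtain ⟨hp₂, hh₂⟩ := h₂
    obtain ⟨hp₁, hh₁⟩ := h₁
    have hn : ∀ r ∈ partialEval P a, r.neg = ∅ ∧ r.nneg = ∅ := fun r hr =>
      ⟨(hHorn r hr).2, (hHorn r hr).1.1⟩
    have hfail : ∀ r ∈ partialEval P a, a ∉ r.head → a ∉ r.pos → r.pos ⊆ X →
        (r.head ∩ X).Nonempty := by
      intro r hr hah hap hp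
      refine (hHorn r hr).satBy_iff.1 (hX r ⟨hr, ?_⟩) hp
      simp [Rule.atoms, hn r hr, hah, hap]
    have ha₂ : a ∉ r₂.pos := fun h => (hp₂ h).2 rfl
    have hp₂' : r₂.pos ⊆ X := hp₂.trans Set.sdiff_subset
    have hhead₂ : r₂.head = {a} := by
      by_cases hah : a ∈ r₂.head
      · exact (hP r₂ hr₂).1.2.eq_singleton_of_mem hah
      · obtain ⟨x, hx, hxX⟩ := hfail r₂ (Or.inl hr₂) hah ha₂ hp₂'
        exact absurd ⟨hxX, fun h => hah (h ▸ hx)⟩ (Set.disjoint_left.1 hh₂ hx)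
    have ha₁ : a ∉ r₁.head := fun h => Set.disjoint_left.1 hh₁ h (Or.inr rfl)
    have hX₁ : ∀ x ∈ r₁.head, x ∉ X := fun x hx hxX => Set.disjoint_left.1 hh₁ hx (Or.inl hxX)
    have hp₁' : r₁.pos \ {a} ⊆ X := by
      rintro x ⟨hx, hxa⟩
      exact (hp₁ hx).resolve_right hxa
    by_cases hap : a ∈ r₁.pos
    · obtain ⟨x, hx, hxX⟩ := hfail
        ⟨r₁.head, (r₁.pos \ {a}) ∪ r₂.pos, r₁.neg ∪ r₂.neg, r₁.nneg ∪ r₂.nneg⟩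
        (Or.inr ⟨r₁, hr₁, r₂, hr₂, hap, hhead₂, rfl⟩) ha₁ (by simp [ha₂])
        (Set.union_subset hp₁' hp₂')
      exact hX₁ x hx hxX
    · rw [Set.sdiff_singleton_eq_self hap] at hp₁'
      obtain ⟨x, hx, hxX⟩ := hfail r₁ (Or.inl hr₁) ha₁ hap hp₁'
      exact hX₁ x hx hxX
  · rintro ⟨H, hH, h⟩
    have hmem : H ∈ modelSet (forgetStrong P a) := fun r hr =>
      (modelSet_partialEval hP a).symm.subset hH r hr.1
    refine determinedOn_modelSet (forgetStrong_mem_hornPrograms hP a) (S := {a}ᶜ) ?_ ?_ hmem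
    · rintro x ⟨r, hr, hx⟩ rfl
      exact hr.2 hx
    · rw [← Set.sdiff_eq, ← Set.sdiff_eq, h]

theorem Enumerates.setOf_eq {l : List α} {V : Set α} (h : Enumerates l V) : {a | a ∈ l} = V :=
  Set.ext h.2

theorem saturation_setOf_mem_cons (K : Set (Set α)) (a : α) (l : List α) :
    saturation (saturation K {a}) {b | b ∈ l} = saturation K {b | b ∈ a :: l} := by
  rw [saturation_saturation]
  congr 1
  ext b
  simp

theorem foldl_forgetStrong {P : Program α} (hP : P ∈ hornPrograms α) (l : List α) :
    l.foldl forgetStrong P ∈ hornPrograms α ∧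
      modelSet (l.foldl forgetStrong P) = saturation (modelSet P) {a | a ∈ l} := by
  induction l generalizing P with
  | nil => exact ⟨hP, by simp [saturation_empty]⟩
  | cons a l ih =>
    have h := ih (forgetStrong_mem_hornPrograms hP a)
    rwa [modelSet_forgetStrong hP, saturation_setOf_mem_cons] at h

theorem foldl_forgetWeak_eq {P : Program α} (hP : P ∈ hornPrograms α) (l : List α) :
    l.foldl forgetWeak P = l.foldl forgetStrong P := by
  induction l generalizing P with
  | nil => rfl
  | cons a l ih =>
    rw [List.foldl_cons, List.foldl_cons, forgetWeak_eq_forgetStrong hP,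
      ih (forgetStrong_mem_hornPrograms hP a)]

theorem HT_foldl_forgetStrong {P : Program α} (hP : P ∈ hornPrograms α) {l : List α} {V : Set α}
    (hl : Enumerates l V) : HT (l.foldl forgetStrong P) = htPairs (saturation (modelSet P) V) := by
  obtain ⟨h, h'⟩ := foldl_forgetStrong hP l
  rw [HT_eq_htPairs_modelSet h, h', hl.setOf_eq]

/-! ### Semantic strong forgetting -/

/-- The rules whose head loses `a` contain `not a` and are removed afterwards, so what remains of
`Cn P` are the rules without `a`. -/
theorem mem_PS_iff {P : Program α} {a : α} {r : Rule α} : r ∈ PS P a ↔ r ∈ Cn P ∧ a ∉ r.atoms := by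
  constructor
  · rintro ⟨⟨r', hr', hap, rfl⟩, hn, hh⟩
    by_cases ha : a ∈ r'.neg
    · simp [ha] at hn
    · rw [if_neg ha] at hh ⊢
      have hnn : r'.nneg = ∅ := hr'.1
      exact ⟨hr', by simp [Rule.atoms, ha, hap, hh, hnn]⟩
  · rintro ⟨hr, ha⟩
    simp only [Rule.atoms, Set.mem_union, not_or] at ha
    obtain ⟨⟨⟨hh, hp⟩, hn⟩, -⟩ := ha
    exact ⟨⟨r, hr, hp, by rw [if_neg hn]⟩, hn, hh⟩

/-- The tautologies `x ← x` make sure that no atom other than `a` disappears. -/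
theorem atoms_PS (P : Program α) (a : α) : atoms (PS P a) = atoms P \ {a} := by
  ext x
  constructor
  · rintro ⟨r, hr, hx⟩
    rw [mem_PS_iff] at hr
    exact ⟨hr.1.2.2 hx, by rintro rfl; exact hr.2 hx⟩
  · rintro ⟨hx, hxa⟩
    refine ⟨⟨{x}, {x}, ∅, ∅⟩, mem_PS_iff.2 ⟨⟨rfl, ?_, by simpa [Rule.atoms] using hx⟩, ?_⟩,
      by simp [Rule.atoms]⟩
    · rw [HTEntails_singleton_iff]
      intro X Y _ _ _
      simp
    · simpa [Rule.atoms, eq_comm] using hxa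

theorem htSat_of_mem_htPairs_saturation {K : Set (Set α)} {V : Set α} (hK : InfClosed K)
    {r : Rule α} (hrV : Disjoint r.atoms V) (hr : ∀ X Y, (X, Y) ∈ htPairs K → r.HTSat X Y)
    {X Y : Set α} (hXY : (X, Y) ∈ htPairs (saturation K V)) : r.HTSat X Y := by
  rw [← dagger_htPairs hK] at hXY
  obtain ⟨-, ⟨H, T⟩, hHT, hX, hY⟩ := hXY
  refine (hr H T hHT).congr (S := Vᶜ) (Set.subset_compl_iff_disjoint_right.2 hrV) ?_ ?_
  · rw [← Set.sdiff_eq, ← Set.sdiff_eq]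
    exact hX.symm
  · rw [← Set.sdiff_eq, ← Set.sdiff_eq]
    exact hY.symm

theorem mem_hornTheory_saturation {K : Set (Set α)} {V S : Set α} {r : Rule α}
    (hr : r ∈ hornTheory (saturation K V) S) : ∀ X Y, (X, Y) ∈ htPairs K → r.HTSat X Y :=
  fun _ _ hXY => hr.1.htSat_iff.2 ⟨hr.2.2 _ (subset_saturation K V hXY.2.1),
    hr.2.2 _ (subset_saturation K V hXY.2.2)⟩

theorem HT_PS [Finite α] {P : Program α} {K : Set (Set α)} (hK : InfClosed K)
    (hdet : DeterminedOn K (atoms P)) (hP : HT P = htPairs K) (a : α) :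
    HT (PS P a) = htPairs (saturation K {a}) := by
  refine HT_eq_htPairs_of_hornTheory_subset (infClosed_saturation hK {a})
    (hdet.saturation {a}) ?_ ?_
  · intro r hr
    refine mem_PS_iff.2 ⟨⟨hr.1.1.1, ?_, hr.2.1.trans Set.sdiff_subset⟩, fun h => (hr.2.1 h).2 rfl⟩
    rw [HTEntails_singleton_iff, hP]
    exact mem_hornTheory_saturation hr
  · intro r hr X Y hXY
    rw [mem_PS_iff] at hr
    refine htSat_of_mem_htPairs_saturation hK (by simpa using hr.2) ?_ hXY
    rw [← hP]
    exact HTEntails_singleton_iff.1 hr.1.2.1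

theorem HT_foldl_PS [Finite α] {P : Program α} {K : Set (Set α)} (hK : InfClosed K)
    (hdet : DeterminedOn K (atoms P)) (hP : HT P = htPairs K) (l : List α) :
    HT (l.foldl PS P) = htPairs (saturation K {a | a ∈ l}) := by
  induction l generalizing P K with
  | nil => simp [saturation_empty, hP]
  | cons a l ih =>
    have h := ih (infClosed_saturation hK {a}) (by rw [atoms_PS]; exact hdet.saturation {a})
      (HT_PS hK hdet hP a)
    rwa [saturation_setOf_mem_cons] at h

/-! ### The inference system for disjunctive rules -/

/-- Soundness of the inference system. -/
theorem SEDerives.htSat {P : Program α} {r : Rule α} (hr : SEDerives P r) {X Y : Set α}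
    (hXY : (X, Y) ∈ HT P) : r.HTSat X Y := by
  induction hr with
  | ax r hr => exact (mem_HT_iff.1 hXY).2 r hr
  | taut x => intro _ _; simp
  | contra x =>
    intro hn _
    have hxY : x ∉ Y := by simpa using hn
    exact ⟨fun h => absurd (h rfl) hxY, fun h => absurd (hXY.1 (h rfl)) hxY⟩
  | nonmin A B C X' Y' Z _ ih =>
    intro hn hnn
    obtain ⟨h₁, h₂⟩ := ih (hn.mono_left Set.subset_union_left) hnn
    exact ⟨fun hp => (h₁ (Set.subset_union_left.trans hp)).mono
        (Set.inter_subset_inter_left _ Set.subset_union_left),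
      fun hp => (h₂ (Set.subset_union_left.trans hp)).mono
        (Set.inter_subset_inter_left _ Set.subset_union_left)⟩
  | wgppe A₁ B₁ C₁ A₂ B₂ C₂ x _ _ ih₁ ih₂ =>
    intro hn hnn
    obtain ⟨h₁, h₁'⟩ := ih₁ (hn.mono_left Set.subset_union_left) hnn
    obtain ⟨h₂, h₂'⟩ := ih₂ (hn.mono_left Set.subset_union_right) hnn
    have key : ∀ Z : Set α, (B₁ ∪ {x} ⊆ Z → (A₁ ∩ Z).Nonempty) →
        (B₂ ⊆ Z → ((A₂ ∪ {x}) ∩ Z).Nonempty) → B₁ ∪ B₂ ⊆ Z → ((A₁ ∪ A₂) ∩ Z).Nonempty := by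
      intro Z h₁ h₂ hp
      rw [Set.union_subset_iff] at hp
      obtain ⟨y, hy | rfl, hyZ⟩ := h₂ hp.2
      · exact ⟨y, Or.inr hy, hyZ⟩
      · exact (h₁ (Set.union_subset hp.1 (by simpa using hyZ))).mono
          (Set.inter_subset_inter_left _ Set.subset_union_left)
    exact ⟨key Y h₁ h₂, key X h₁' h₂'⟩
  | shyp n A' B' C' x A C _ _ ih ih₀ =>
    intro hn hnn
    simp only [Set.disjoint_union_left, Set.disjoint_iUnion_left] at hn
    obtain ⟨⟨hC', hA⟩, hC⟩ := hn
    -- As `A` and `C` are false in `Y`, one of the `x i` is too, so the rule with `not x i` applies.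
    obtain ⟨i, hi⟩ : ∃ i, x i ∉ Y := by
      by_contra! h
      obtain ⟨y, hy, hyY⟩ := (ih₀ hC hnn).1 (Set.range_subset_iff.2 h)
      exact Set.disjoint_left.1 hA hy hyY
    obtain ⟨h₁, h₂⟩ := ih i (Set.disjoint_union_left.2 ⟨hC' i, by simpa using hi⟩) hnn
    exact ⟨fun hp => (h₁ ((Set.subset_iUnion B' i).trans hp)).mono
        (Set.inter_subset_inter_left _ (Set.subset_iUnion A' i)),
      fun hp => (h₂ ((Set.subset_iUnion B' i).trans hp)).mono
        (Set.inter_subset_inter_left _ (Set.subset_iUnion A' i))⟩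

/-- Resolving away the body atoms in `C` one after the other. -/
theorem SEDerives.cut {P : Program α} {A B C : Set α} (hC : C.Finite)
    (h : SEDerives P ⟨A, C ∪ B, ∅, ∅⟩) (hx : ∀ x ∈ C, SEDerives P ⟨{x}, B, ∅, ∅⟩) :
    SEDerives P ⟨A, B, ∅, ∅⟩ := by
  induction C, hC using Set.Finite.induction_on with
  | empty => simpa using h
  | @insert x C _ _ ih =>
    refine ih ?_ fun y hy => hx y (Or.inr hy)
    have h₁ : SEDerives P ⟨A, (C ∪ B) ∪ {x}, ∅, ∅⟩ := by
      rwa [Set.union_singleton, ← Set.insert_union]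
    have h₂ : SEDerives P ⟨∅ ∪ {x}, B, ∅, ∅⟩ := by
      rw [Set.empty_union]
      exact hx x (Or.inl rfl)
    simpa [Set.union_assoc] using SEDerives.wgppe _ _ _ _ _ _ x h₁ h₂

/-- Completeness for Horn rules: unless `← B` is derivable, the atoms `y` with `y ← B` derivable
form a model of `P` that contains `B`. -/
theorem SEDerives.of_isHorn [Finite α] {P : Program α} (hP : P ∈ hornPrograms α) {r : Rule α}
    (hr : r.IsHorn) (h : ∀ M ∈ modelSet P, r.SatBy M) : SEDerives P r := by
  obtain ⟨A, B, C, D⟩ := r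
  obtain ⟨⟨rfl : D = ∅, hA⟩, rfl : C = ∅⟩ := id hr
  by_cases hB : SEDerives P ⟨∅, B, ∅, ∅⟩
  · simpa using SEDerives.nonmin _ _ _ A ∅ ∅ hB
  have hmodel : {y | SEDerives P ⟨{y}, B, ∅, ∅⟩} ∈ modelSet P := by
    intro s hs
    refine (hP s hs).satBy_iff.2 fun hp => ?_
    have hsB : SEDerives P ⟨s.head, B, ∅, ∅⟩ := by
      refine SEDerives.cut (C := s.pos) (Set.toFinite _) ?_ hp
      have hs' := SEDerives.ax s hs
      obtain ⟨A', B', C', D'⟩ := s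
      obtain ⟨⟨rfl : D' = ∅, -⟩, rfl : C' = ∅⟩ := hP _ hs
      simpa using SEDerives.nonmin _ _ _ ∅ B ∅ hs'
    obtain hempty | ⟨y, hy⟩ := s.head.eq_empty_or_nonempty
    · exact absurd (hempty ▸ hsB) hB
    · rw [(hP s hs).1.2.eq_singleton_of_mem hy] at hsB ⊢
      exact ⟨y, rfl, hsB⟩
  have hBM : B ⊆ {y | SEDerives P ⟨{y}, B, ∅, ∅⟩} := by
    intro y hy
    simpa [hy] using SEDerives.nonmin _ _ _ ∅ B ∅ (SEDerives.taut (P := P) y)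
  obtain ⟨y, hyA, hy⟩ := hr.satBy_iff.1 (h _ hmodel) hBM
  have hAy : A = {y} := hA.eq_singleton_of_mem hyA
  rw [hAy]
  exact hy

theorem HT_CnSE_inter [Finite α] {P : Program α} (hP : P ∈ hornPrograms α) (V : Set α) :
    HT (CnSE P ∩ {r | r.atoms ⊆ atoms P \ V}) = htPairs (saturation (modelSet P) V) := by
  refine HT_eq_htPairs_of_hornTheory_subset (S := atoms P \ V)
    (infClosed_saturation (infClosed_modelSet hP) V)
    ((determinedOn_modelSet hP subset_rfl).saturation V) ?_ ?_
  · intro r hr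
    exact ⟨⟨hr.1.1.1, .of_isHorn hP hr.1 fun M hM => hr.2.2 M (subset_saturation _ V hM)⟩, hr.2.1⟩
  · rintro r ⟨⟨-, hr⟩, hrV : r.atoms ⊆ atoms P \ V⟩ X Y hXY
    refine htSat_of_mem_htPairs_saturation (infClosed_modelSet hP)
      (Set.disjoint_sdiff_left.mono_left hrV) (fun X Y h => hr.htSat ?_) hXY
    rwa [HT_eq_htPairs_modelSet hP]

/-! ### Answer sets -/

theorem isSMCandidate_htPairs [Finite α] {P : Program α} (hP : P ∈ hornPrograms α) (V : Set α) :
    IsSMCandidate P V (htPairs (saturation (modelSet P) V)) := by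
  have hK := infClosed_modelSet hP
  have hHT := HT_hornTheory (infClosed_saturation hK V)
    ((determinedOn_modelSet hP subset_rfl).saturation V)
  refine ⟨_, atoms_hornTheory_subset _ _, hHT.symm, ?_, ?_⟩
  · rw [HT_eq_htPairs_modelSet hP, dagger_htPairs hK]
  · ext Y
    rw [mem_AS_iff_isLeast (infClosed_saturation hK V) hHT, isLeast_saturation_iff hK]
    simp only [exclude, Set.mem_ofPred_eq, mem_AS_iff_isLeast hK (HT_eq_htPairs_modelSet hP)]

theorem exclude_AS_union [Finite α] {P R : Program α} (hP : P ∈ hornPrograms α)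
    (hR : R ∈ hornPrograms α) {V : Set α} (hRV : atoms R ⊆ Vᶜ) :
    exclude V (AS (P ∪ R)) = {Y | IsLeast (saturation (modelSet P) V ∩ modelSet R) Y} := by
  have hPR := union_mem_hornPrograms hP hR
  have hK := infClosed_modelSet hPR
  ext Y
  rw [← saturation_inter_of_determinedOn (determinedOn_modelSet hR hRV), ← modelSet_union,
    Set.mem_ofPred_eq, isLeast_saturation_iff hK]
  simp only [exclude, Set.mem_ofPred_eq, mem_AS_iff_isLeast hK (HT_eq_htPairs_modelSet hPR)]

/-- The facts `X` together with the rules `y ← y'` for all `y, y' ∈ Y \ X`. For `X ⊆ Y`, its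
models inside `Y` are `X` and `Y`. -/
def factsAndLoops (X Y : Set α) : Program α :=
  {r | ∃ x ∈ X, r = ⟨{x}, ∅, ∅, ∅⟩} ∪ {r | ∃ y ∈ Y \ X, ∃ y' ∈ Y \ X, r = ⟨{y}, {y'}, ∅, ∅⟩}

theorem factsAndLoops_mem_hornPrograms (X Y : Set α) : factsAndLoops X Y ∈ hornPrograms α := by
  rintro r (⟨x, -, rfl⟩ | ⟨y, -, y', -, rfl⟩) <;>
  exact ⟨⟨rfl, Set.subsingleton_singleton⟩, rfl⟩

theorem atoms_factsAndLoops_subset {X Y S : Set α} (hX : X ⊆ S) (hY : Y ⊆ S) :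
    atoms (factsAndLoops X Y) ⊆ S := by
  rintro a ⟨r, ⟨x, hx, rfl⟩ | ⟨y, hy, y', hy', rfl⟩, ha⟩
  · simp only [Rule.atoms, Set.union_empty, Set.mem_singleton_iff] at ha
    exact ha ▸ hX hx
  · simp only [Rule.atoms, Set.union_empty, Set.mem_union, Set.mem_singleton_iff] at ha
    rcases ha with rfl | rfl
    exacts [hY hy.1, hY hy'.1]

theorem mem_modelSet_factsAndLoops {X Y Z : Set α} :
    Z ∈ modelSet (factsAndLoops X Y) ↔
      X ⊆ Z ∧ ∀ y ∈ Y \ X, ∀ y' ∈ Y \ X, y' ∈ Z → y ∈ Z := by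
  constructor
  · intro h
    refine ⟨fun x hx => ?_, fun y hy y' hy' hZ => ?_⟩
    · simpa [Rule.SatBy] using h _ (Or.inl ⟨x, hx, rfl⟩)
    · simpa [Rule.SatBy, hZ] using h _ (Or.inr ⟨y, hy, y', hy', rfl⟩)
  · rintro ⟨h₁, h₂⟩ r (⟨x, hx, rfl⟩ | ⟨y, hy, y', hy', rfl⟩)
    · simpa [Rule.SatBy] using h₁ hx
    · simpa [Rule.SatBy] using h₂ y hy y' hy'

theorem eq_or_eq_of_mem_modelSet_factsAndLoops {X Y Z : Set α}
    (hZ : Z ∈ modelSet (factsAndLoops X Y)) (hZY : Z ⊆ Y) : Z = X ∨ Z = Y := by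
  rw [mem_modelSet_factsAndLoops] at hZ
  by_cases h : Z ⊆ X
  · exact Or.inl (h.antisymm hZ.1)
  · obtain ⟨z, hz, hzX⟩ := Set.not_subset.1 h
    refine Or.inr (hZY.antisymm fun y hy => ?_)
    by_cases hyX : y ∈ X
    · exact hZ.1 hyX
    · exact hZ.2 y ⟨hy, hyX⟩ z ⟨hZY hz, hzX⟩ hz

theorem left_mem_modelSet_factsAndLoops (X Y : Set α) : X ∈ modelSet (factsAndLoops X Y) :=
  mem_modelSet_factsAndLoops.2 ⟨subset_rfl, fun _ _ _ hy' h => absurd h hy'.2⟩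

theorem right_mem_modelSet_factsAndLoops {X Y : Set α} (h : X ⊆ Y) :
    Y ∈ modelSet (factsAndLoops X Y) :=
  mem_modelSet_factsAndLoops.2 ⟨h, fun _ hy _ _ _ => hy.1⟩

theorem mem_AS_union_factsAndLoops {G : Program α} {X Y : Set α} (hXY : X ⊆ Y) :
    Y ∈ AS (G ∪ factsAndLoops X Y) ↔ (Y, Y) ∈ HT G ∧ (X ≠ Y → (X, Y) ∉ HT G) := by
  have hX := left_mem_modelSet_factsAndLoops X Y
  have hY := right_mem_modelSet_factsAndLoops hXY
  simp only [AS, HT_union, HT_eq_htPairs_modelSet (factsAndLoops_mem_hornPrograms X Y), htPairs,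
    Set.mem_ofPred_eq, Set.mem_inter_iff]
  constructor
  · rintro ⟨⟨hYG, -⟩, hmin⟩
    exact ⟨hYG, fun hne hXG => hmin ⟨X, hXY.ssubset_of_ne hne, hXG, hXY, hX, hY⟩⟩
  · rintro ⟨hYG, h⟩
    refine ⟨⟨hYG, subset_rfl, hY, hY⟩, ?_⟩
    rintro ⟨Z, hZY, hZG, -, hZ, -⟩
    obtain rfl | rfl := eq_or_eq_of_mem_modelSet_factsAndLoops hZ hZY.1
    · exact h hZY.ne hZG
    · exact hZY.ne rfl

theorem isLeast_inter_modelSet_factsAndLoops {K : Set (Set α)} (hK : InfClosed K) {X Y : Set α}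
    (hXY : X ⊆ Y) :
    IsLeast (K ∩ modelSet (factsAndLoops X Y)) Y ↔ Y ∈ K ∧ (X ≠ Y → X ∉ K) := by
  have hX := left_mem_modelSet_factsAndLoops X Y
  have hY := right_mem_modelSet_factsAndLoops hXY
  constructor
  · rintro ⟨⟨hYK, -⟩, hle⟩
    exact ⟨hYK, fun hne hXK => hne (hXY.antisymm (hle ⟨hXK, hX⟩))⟩
  · rintro ⟨hYK, h⟩
    refine ⟨⟨hYK, hY⟩, fun Z hZ => ?_⟩
    have hmem := infClosed_modelSet (factsAndLoops_mem_hornPrograms X Y) hZ.2 hY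
    have hZK : Z ∩ Y ∈ K := hK hZ.1 hYK
    obtain heq | heq := eq_or_eq_of_mem_modelSet_factsAndLoops hmem Set.inter_subset_right
    · have heq' : Z ∩ Y = X := heq
      by_cases hne : X = Y
      · exact Set.inter_eq_right.1 (heq'.trans hne)
      · exact absurd (heq' ▸ hZK) (h hne)
    · exact Set.inter_eq_right.1 heq

/-- Horn contexts suffice to tell the HT-models of a program apart from `htPairs K`: the facts `Y`
detect the total models, and the facts `X` with the loops on `Y \ X` detect `⟨X, Y⟩`. -/
theorem HT_eq_htPairs_of_AS_union {G : Program α} {K : Set (Set α)} {S : Set α}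
    (hG : atoms G ⊆ S) (hK : InfClosed K) (hS : DeterminedOn K S)
    (h : ∀ R ∈ hornPrograms α, atoms R ⊆ S → AS (G ∪ R) = {Y | IsLeast (K ∩ modelSet R) Y}) :
    HT G = htPairs K := by
  have key : ∀ X Y, X ⊆ Y → Y ⊆ S →
      ((Y, Y) ∈ HT G ∧ (X ≠ Y → (X, Y) ∉ HT G) ↔ Y ∈ K ∧ (X ≠ Y → X ∉ K)) := by
    intro X Y hXY hYS
    rw [← mem_AS_union_factsAndLoops hXY, ← isLeast_inter_modelSet_factsAndLoops hK hXY,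
      h _ (factsAndLoops_mem_hornPrograms X Y) (atoms_factsAndLoops_subset (hXY.trans hYS) hYS)]
    rfl
  refine HT_eq_htPairs_of_forall_subset hG hS subset_rfl fun X Y hXY hYS => ?_
  have htot : (Y, Y) ∈ HT G ↔ Y ∈ K := by simpa using key Y Y subset_rfl hYS
  have hXYiff := key X Y hXY hYS
  have htotal : (X, Y) ∈ HT G → (Y, Y) ∈ HT G := fun hm => by
    rw [mem_HT_iff] at hm ⊢
    exact ⟨subset_rfl, fun r hr hn hnn => ⟨(hm.2 r hr hn hnn).1, (hm.2 r hr hn hnn).1⟩⟩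
  by_cases hne : X = Y
  · subst hne
    simpa using htot
  · tauto

/-! ### Relativized and uniform forgetting -/

/-- The least of the sets `A ⊆ V` for which `Y ∪ A` is a model exists as soon as `Y` is a model up
to `V`. -/
theorem exists_least_extension [Finite α] {K : Set (Set α)} (hK : InfClosed K) {V Y : Set α}
    (hYV : Y ⊆ Vᶜ) (hY : Y ∈ saturation K V) :
    ∃ A ⊆ V, Y ∪ A ∈ K ∧ ∀ B ⊆ V, Y ∪ B ∈ K → A ⊆ B := by
  have hclosed : InfClosed {A | A ⊆ V ∧ Y ∪ A ∈ K} := by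
    rintro A ⟨hA, hAK⟩ B ⟨-, hBK⟩
    refine ⟨Set.inter_subset_left.trans hA, ?_⟩
    change Y ∪ A ∩ B ∈ K
    rw [Set.union_inter_distrib_left]
    exact hK hAK hBK
  have hne : {A | A ⊆ V ∧ Y ∪ A ∈ K}.Nonempty := by
    obtain ⟨H, hH, h⟩ := hY
    refine ⟨H ∩ V, Set.inter_subset_right, ?_⟩
    rw [sdiff_eq_left.2 (Set.subset_compl_iff_disjoint_right.1 hYV)] at h
    rwa [h, Set.sdiff_union_inter]
  obtain ⟨A, ⟨hA, hAK⟩, hle⟩ := exists_isLeast_of_infClosed hclosed hne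
  exact ⟨A, hA, hAK, fun B hB hBK => hle ⟨hB, hBK⟩⟩

theorem union_diff_of_subset {V Y A : Set α} (hYV : Y ⊆ Vᶜ) (hA : A ⊆ V) : (Y ∪ A) \ V = Y := by
  rw [Set.union_sdiff_distrib, Set.sdiff_eq_empty.2 hA, Set.union_empty,
    sdiff_eq_left.2 (Set.subset_compl_iff_disjoint_right.1 hYV)]

theorem mem_saturation_of_union_mem {K : Set (Set α)} {V Y A : Set α} (hYV : Y ⊆ Vᶜ) (hA : A ⊆ V)
    (h : Y ∪ A ∈ K) : Y ∈ saturation K V := by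
  refine ⟨_, h, ?_⟩
  rw [union_diff_of_subset hYV hA, sdiff_eq_left.2 (Set.subset_compl_iff_disjoint_right.1 hYV)]

theorem mem_HT_iff_of_isHorn {P : Program α} (hP : P ∈ hornPrograms α) {X Y : Set α} :
    (X, Y) ∈ HT P ↔ X ⊆ Y ∧ X ∈ modelSet P ∧ Y ∈ modelSet P := by
  rw [HT_eq_htPairs_modelSet hP]
  rfl

theorem RSet_eq {P : Program α} (hP : P ∈ hornPrograms α) {V Y A : Set α} (hYV : Y ⊆ Vᶜ)
    (hA : A ⊆ V) (hYA : Y ∪ A ∈ modelSet P) :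
    RSet P V Y A = {X | X ⊆ Y ∧ X ∈ saturation (modelSet P) V} := by
  ext Z
  constructor
  · rintro ⟨X, hX, rfl⟩
    rw [mem_HT_iff_of_isHorn hP] at hX
    refine ⟨?_, diff_mem_saturation (subset_saturation _ V hX.2.1)⟩
    exact (Set.sdiff_subset_sdiff_left hX.1).trans (union_diff_of_subset hYV hA).subset
  · rintro ⟨hZY, H, hH, h⟩
    rw [sdiff_eq_left.2 (Set.subset_compl_iff_disjoint_right.1 (hZY.trans hYV))] at h
    refine ⟨H ⊓ (Y ∪ A), (mem_HT_iff_of_isHorn hP).2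
      ⟨Set.inter_subset_right, infClosed_modelSet hP hH hYA, hYA⟩, ?_⟩
    rw [inf_sdiff, ← h, union_diff_of_subset hYV hA]
    exact (Set.inter_eq_left.2 hZY).symm

/-- The models of a Horn program admit at most one minimal choice of `A`, and all choices give the
same `R^{Y,A}`; hence the family `𝓡^Y` has at most one member. -/
theorem RFam_eq [Finite α] {P : Program α} (hP : P ∈ hornPrograms α) {V Y : Set α}
    (hYV : Y ⊆ Vᶜ) :
    RFam P V Y = {S | Y ∈ saturation (modelSet P) V ∧
      S = {X | X ⊆ Y ∧ X ∈ saturation (modelSet P) V}} := by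
  ext S
  constructor
  · rintro ⟨A, ⟨hA, hYA, -⟩, rfl⟩
    have hYA := ((mem_HT_iff_of_isHorn hP).1 hYA).2.2
    exact ⟨mem_saturation_of_union_mem hYV hA hYA, RSet_eq hP hYV hA hYA⟩
  · rintro ⟨hY, rfl⟩
    obtain ⟨A, hA, hAK, hmin⟩ := exists_least_extension (infClosed_modelSet hP) hYV hY
    refine ⟨A, ⟨hA, (mem_HT_iff_of_isHorn hP).2 ⟨subset_rfl, hAK, hAK⟩, ?_⟩,
      (RSet_eq hP hYV hA hAK).symm⟩
    rintro ⟨B, hB, hBK⟩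
    exact hB.2 (hmin B (hB.1.trans hA) ((mem_HT_iff_of_isHorn hP).1 hBK).2.1)

theorem mem_sUnion_RFam_iff [Finite α] {P : Program α} (hP : P ∈ hornPrograms α) {V X Y : Set α}
    (hYV : Y ⊆ Vᶜ) :
    X ∈ ⋃₀ RFam P V Y ↔ X ⊆ Y ∧ X ∈ saturation (modelSet P) V ∧ Y ∈ saturation (modelSet P) V := by
  simp only [RFam_eq hP hYV, Set.mem_sUnion, Set.mem_ofPred_eq]
  constructor
  · rintro ⟨_, ⟨hY, rfl⟩, hX⟩
    exact ⟨hX.1, hX.2, hY⟩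
  · rintro ⟨hXY, hX, hY⟩
    exact ⟨_, ⟨hY, rfl⟩, hXY, hX⟩

theorem interFam_RFam [Finite α] {P : Program α} (hP : P ∈ hornPrograms α) {V Y : Set α}
    (hYV : Y ⊆ Vᶜ) : interFam (RFam P V Y) = ⋃₀ RFam P V Y := by
  by_cases hY : Y ∈ saturation (modelSet P) V
  · have h : RFam P V Y = {{X | X ⊆ Y ∧ X ∈ saturation (modelSet P) V}} := by
      rw [RFam_eq hP hYV]
      ext S
      simp [hY]
    ext X
    simp [h, interFam]
  · have h : RFam P V Y = ∅ := by
      rw [RFam_eq hP hYV]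
      ext S
      simp [hY]
    ext X
    simp [h, interFam]

theorem mem_TSet_iff [Finite α] {P : Program α} (hP : P ∈ hornPrograms α) {V Y : Set α}
    (hYV : Y ⊆ Vᶜ) : Y ∈ TSet P V ↔ Y ∈ saturation (modelSet P) V := by
  constructor
  · rintro ⟨-, A, ⟨hA, hYA⟩, -⟩
    exact mem_saturation_of_union_mem hYV hA ((mem_HT_iff_of_isHorn hP).1 hYA).2.2
  · intro hY
    obtain ⟨A, hA, hAK, hmin⟩ := exists_least_extension (infClosed_modelSet hP) hYV hY
    refine ⟨hYV, A, ⟨hA, (mem_HT_iff_of_isHorn hP).2 ⟨subset_rfl, hAK, hAK⟩⟩, fun B hB hBK => ?_⟩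
    exact hB.2 (hmin B (hB.1.trans hA) ((mem_HT_iff_of_isHorn hP).1 hBK).2.1)

/-- The component at the least selected `A` makes every intersection a proper subset of `Y`;
conversely, a proper subset of `Y` that is a model up to `V` is the intersection of the constant
tuple. -/
theorem mem_SInt_iff [Finite α] {P : Program α} (hP : P ∈ hornPrograms α) {V X Y : Set α}
    (hYV : Y ⊆ Vᶜ) (hY : Y ∈ saturation (modelSet P) V) :
    X ∈ SInt P V Y ↔ X ⊂ Y ∧ X ∈ saturation (modelSet P) V := by
  have hKV := infClosed_saturation (infClosed_modelSet hP) V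
  obtain ⟨A, hA, hAK, hmin⟩ := exists_least_extension (infClosed_modelSet hP) hYV hY
  have hASel : A ∈ Sel P V Y := ⟨hA, (mem_HT_iff_of_isHorn hP).2 ⟨subset_rfl, hAK, hAK⟩⟩
  have hne : Nonempty (Sel P V Y) := ⟨⟨A, hASel⟩⟩
  constructor
  · rintro ⟨F, hF, rfl⟩
    refine ⟨?_, hKV.iInf_mem_of_nonempty fun i => ?_⟩
    · obtain ⟨X, hX, hXne, hFX⟩ := hF ⟨A, hASel⟩
      rw [mem_HT_iff_of_isHorn hP] at hX
      have hsub : X \ V ⊆ Y :=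
        (Set.sdiff_subset_sdiff_left hX.1).trans (union_diff_of_subset hYV hA).subset
      refine ((Set.iInter_subset F ⟨A, hASel⟩).trans hFX.subset).trans_ssubset
        (hsub.ssubset_of_ne fun hXV => hXne (hX.1.antisymm ?_))
      have hX' : Y ∪ X ∩ V = X := by rw [← hXV, Set.sdiff_union_inter]
      have hAX := hmin (X ∩ V) Set.inter_subset_right (hX'.symm ▸ hX.2.1)
      exact Set.union_subset (hXV.symm.subset.trans Set.sdiff_subset)
        (hAX.trans Set.inter_subset_left)
    · obtain ⟨X, hX, -, hFX⟩ := hF i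
      rw [hFX]
      exact diff_mem_saturation (subset_saturation _ V ((mem_HT_iff_of_isHorn hP).1 hX).2.1)
  · rintro ⟨hXY, hX⟩
    refine ⟨fun _ => X, fun i => ?_, (Set.iInter_const X).symm⟩
    have hi := ((mem_HT_iff_of_isHorn hP).1 i.2.2).2.2
    obtain ⟨Z, hZ, hXZ⟩ := (RSet_eq hP hYV i.2.1 hi).symm.subset ⟨hXY.1, hX⟩
    refine ⟨Z, hZ, ?_, hXZ⟩
    rintro rfl
    exact hXY.ne (hXZ.trans (union_diff_of_subset hYV i.2.1))

/-! ### HT-models of the results of forgetting from a Horn program -/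

theorem HT_forget_eq_of_HTOn [Finite α] {P G : Program α} (hP : P ∈ hornPrograms α) {V S : Set α}
    (hG : atoms G ⊆ atoms P \ V) (hS : atoms P \ V ⊆ S)
    (h : ∀ X Y, Y ⊆ S → ((X, Y) ∈ HTOn S G ↔
      X ⊆ Y ∧ X ∈ saturation (modelSet P) V ∧ Y ∈ saturation (modelSet P) V)) :
    HT G = htPairs (saturation (modelSet P) V) := by
  refine HT_eq_htPairs_of_forall_subset hG ((determinedOn_modelSet hP subset_rfl).saturation V) hS
    fun X Y hXY hY => ?_
  have h' := h X Y hY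
  simp only [HTOn, Set.mem_ofPred_eq] at h'
  tauto

/-- Whichever of the classes `f` belongs to, the HT-models of the result of forgetting about `V`
from the Horn program `P` are the pairs of models of `∃ V, P`. -/
theorem HT_forget_eq [Finite α] {𝒞 : Set (Program α)} (h𝒞 : hornPrograms α ⊆ 𝒞)
    {f : ForgettingOperator α}
    (hf : f ∈ Fstrong α ∪ Fweak α ∪ FS α ∪ FHT α ∪ FSM α ∪ FSas 𝒞 ∪ FSE α ∪ FSP α ∪ FR α ∪ FM α ∪
      FUP α) {P : Program α} (hP : P ∈ hornPrograms α) (hPf : P ∈ f.domain) (V : Set α) :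
    HT (f.forget P V) = htPairs (saturation (modelSet P) V) := by
  have hK := infClosed_modelSet hP
  have hdet := determinedOn_modelSet hP subset_rfl
  have hatoms := f.atoms_forget P hPf V
  have hSV : atoms P \ V ⊆ Vᶜ := fun _ h => h.2
  rcases hf with (((((((((hf | hf) | hf) | hf) | hf) | hf) | hf) | hf) | hf) | hf) | hf
  · obtain ⟨l, hl, h⟩ := hf.2 P hPf V
    rw [h, HT_foldl_forgetStrong hP hl]
  · obtain ⟨l, hl, h⟩ := hf.2 P hPf V
    rw [h, foldl_forgetWeak_eq hP, HT_foldl_forgetStrong hP hl]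
  · obtain ⟨l, hl, h⟩ := hf.2 P hPf V
    rw [show HT (f.forget P V) = _ from h, HT_foldl_PS hK hdet (HT_eq_htPairs_modelSet hP),
      hl.setOf_eq]
  · rw [hf P hPf V, HT_eq_htPairs_modelSet hP, dagger_htPairs hK]
  · have hmax := hf P hPf V
    refine hmax.eq_of_subset (isSMCandidate_htPairs hP V) ?_
    obtain ⟨Q, -, -, hsub, -⟩ := hmax.prop
    rwa [HT_eq_htPairs_modelSet hP, dagger_htPairs hK] at hsub
  · refine HT_eq_htPairs_of_AS_union hatoms (infClosed_saturation hK V) (hdet.saturation V)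
      fun R hR hRS => ?_
    rw [hf.2 P hPf V R (h𝒞 hR) hRS, exclude_AS_union hP hR (hRS.trans hSV)]
  · rw [show HT (f.forget P V) = _ from hf.2 P hPf V, HT_CnSE_inter hP]
  · refine HT_forget_eq_of_HTOn hP hatoms subset_rfl fun X Y hY => ?_
    rw [hf P hPf V, ← mem_sUnion_RFam_iff hP (hY.trans hSV), ← interFam_RFam hP (hY.trans hSV)]
    exact and_iff_right hY
  · refine HT_forget_eq_of_HTOn hP hatoms hSV fun X Y hY => ?_
    rw [hf P hPf V, ← mem_sUnion_RFam_iff hP hY]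
    exact and_iff_right hY
  · refine HT_forget_eq_of_HTOn hP hatoms hSV fun X Y hY => ?_
    rw [hf P hPf V, ← mem_sUnion_RFam_iff hP hY]
    simp only [Set.mem_ofPred_eq, interFam_RFam hP hY]
    tauto
  · refine HT_forget_eq_of_HTOn hP hatoms hSV fun X Y hY => ?_
    rw [hf P hPf V]
    constructor
    · rintro (⟨Z, hZ, heq⟩ | ⟨hYT : Y ∈ TSet P V, hX : X ∈ SInt P V Y⟩)
      · obtain ⟨rfl, rfl⟩ := Prod.mk.inj heq
        rw [mem_TSet_iff hP hY] at hZ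
        exact ⟨subset_rfl, hZ, hZ⟩
      · rw [mem_TSet_iff hP hY] at hYT
        obtain ⟨hXY, hX⟩ := (mem_SInt_iff hP hY hYT).1 hX
        exact ⟨hXY.1, hX, hYT⟩
    · rintro ⟨hXY, hX, hYK⟩
      have hYT := (mem_TSet_iff hP hY).2 hYK
      obtain rfl | hne := eq_or_ne X Y
      · exact Or.inl ⟨X, hYT, rfl⟩
      · exact Or.inr ⟨hYT, (mem_SInt_iff hP hY hYK).2 ⟨hXY.ssubset_of_ne hne, hX⟩⟩

end ASP

theorem mainTheorem3 {α : Type*} [Finite α] (𝒞₁ 𝒞₂ : Set (ASP.Program α))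
    (h𝒞₁ : ASP.hornPrograms α ⊆ 𝒞₁) (h𝒞₂ : ASP.hornPrograms α ⊆ 𝒞₂)
    (f₁ f₂ : ASP.ForgettingOperator α)
    (hf₁ : f₁ ∈ ASP.Fstrong α ∪ ASP.Fweak α ∪ ASP.FS α ∪ ASP.FHT α ∪ ASP.FSM α ∪ ASP.FSas 𝒞₁ ∪
      ASP.FSE α ∪ ASP.FSP α ∪ ASP.FR α ∪ ASP.FM α ∪ ASP.FUP α)
    (hf₂ : f₂ ∈ ASP.Fstrong α ∪ ASP.Fweak α ∪ ASP.FS α ∪ ASP.FHT α ∪ ASP.FSM α ∪ ASP.FSas 𝒞₂ ∪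
      ASP.FSE α ∪ ASP.FSP α ∪ ASP.FR α ∪ ASP.FM α ∪ ASP.FUP α)
    (P : ASP.Program α) (hP : P ∈ ASP.hornPrograms α)
    (hP₁ : P ∈ f₁.domain) (hP₂ : P ∈ f₂.domain)
    (V : Set α) (hV : V ⊆ ASP.atoms P) :
    ASP.HTEquiv (f₁.forget P V) (f₂.forget P V) ∧
      ASP.StronglyEquiv (f₁.forget P V) (f₂.forget P V) := by
  have h : ASP.HTEquiv (f₁.forget P V) (f₂.forget P V) :=
    (ASP.HT_forget_eq h𝒞₁ hf₁ hP hP₁ V).trans (ASP.HT_forget_eq h𝒞₂ hf₂ hP hP₂ V).symm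
  exact ⟨h, h.stronglyEquiv⟩
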